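/- A *network* is a finite directed acyclic multigraph in which certain nodes (sources) generate messages and certain nodes (receivers) demand messages. Let $\mathcal{A}$ be an alphabet, i.e. a finite set with at least two elements. The inputs of a node are the messages generated at it and the symbols carried by its in-edges. A $(1,1)$ code over $\mathcal{A}$ assigns to each edge a function from the inputs of its tail to $\mathcal{A}$ (the symbol carried by the edge), and to each demand of each receiver a decoding function from the inputs of the receiver to $\mathcal{A}$; all messages take arbitrary values in $\mathcal{A}$. The network is *solvable over $\mathcal{A}$* if there is a $(1,1)$ code such that, for all values of the messages, every receiver recovers all messages it demands. *The block $B(m)$* has message inputs $y_0,\dots,y_m$ and nodes $u,v$ and $u_i,v_i,R_i$ ($0\le i\le m$). The node $u_i$ receives every $y_j$ with $j\ne i$ and has a single out-edge, to $v_i$; the node $u$ receives $y_0,\dots,y_m$ and has a single out-edge, to $v$; the receiver $R_i$ has one in-edge from $v_i$ and one from $v$ and demands $y_i$; the $i$th output edge of the block is a further out-edge of $v_i$. In the networks below every message is generated by its own source node. * $\mathcal{N}_1(m)$: one block $B(m)$ with inputs $x_0,\dots,x_m$, and an additional receiver that receives all output edges of the block and demands $x_0$. * $\mathcal{N}_2(m,w)$: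 blocks $B^{(1)}(m+1),\dots,B^{(w)}(m+1)$, where $B^{(l)}(m+1)$ has inputs $z,x^{(l)}_1,\dots,x^{(l)}_{m+1}$ (the message $z$ is shared and is the $0$th input of every block), and an additional receiver that receives all output edges of all blocks except the $0$th of each block and demands $z$. * $\mathcal{N}_3(m_1,m_2)$: blocks $B^{(1)}(m_1)$ and $B^{(2)}(m_2)$, where $B^{(l)}(m_l)$ has inputs $z,x^{(l)}_1,\dots,x^{(l)}_{m_l}$ (with $z$ shared), and an additional receiver that receives all output edges of both blocks and demands $z$. For an integer $m\ge 2$ with prime factorization $m=p_1^{\gamma_1}\cdots p_\omega^{\gamma_\omega}$ (distinct primes $p_i$, exponents $\gamma_i\ge1$) put $$f(m)=\prod_{i=1}^{\omega}p_i^{\gamma_i-1},\qquad \mu(m,i)=\min\{\alpha\ge 0: p_i^{\alpha}\ge f(m)\},\qquad g(m,i)=p_i^{\gamma_i-1}\prod_{j\ne i}p_j^{\mu(m,j)},$$ and let $\mathcal{N}_4(m)$ be the disjoint union of networks $$\mathcal{N}_4(m)=\Bigl(\bigcup_{\substack{q\text{ prime}\\ q\nmid m,\ q<f(m)}}\mathcal{N}_1(q)\Bigr)\cup\Bigl(\bigcup_{i=1}^{\omega}\mathcal{N}_2\bigl(p_i^{\gamma_i},\,m/p_i^{\gamma_i}\bigr)\Bigr)\cup\Bigl(\bigcup_{i:\,\gamma_i>1}\mathcal{N}_3\bigl(p_i,\,g(m,i)\bigr)\Bigr).$$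 **Theorem.** For each $m\ge 2$, if the network $\mathcal{N}_4(m)$ is solvable over an alphabet $\mathcal{A}$, then $|\mathcal{A}|\ge m$. -/

import Mathlib

namespace NetworkCoding

/-! ### Networks, codes and solutions -/

/-- A network: a finite directed acyclic multigraph, whose nodes may generate messages
(`origin x` is the source node that generates the message `x`) and may demand messages
(`demands v` is the set of messages demanded at `v`). The sources are the nodes in the range of
`origin`, the receivers are the nodes `v` with `demands v` nonempty. -/
structure Network where
  Node : Type
  Edge : Type
  Message : Type
  finite_node : Finite Node
  finite_edge : Finite Edge
  finite_message : Finite Message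
  src : Edge → Node
  tgt : Edge → Node
  acyclic : ∀ v : Node, ¬ Relation.TransGen (fun a b => ∃ e, src e = a ∧ tgt e = b) v v
  origin : Message → Node
  demands : Node → Set Message

namespace Network

variable (N : Network)

/-- There is an edge from `a` to `b`. -/
def Adj (a b : N.Node) : Prop := ∃ e, N.src e = a ∧ N.tgt e = b

theorem wellFounded_adj : WellFounded N.Adj := by
  have := N.finite_node
  have : Std.Irrefl (Relation.TransGen N.Adj) := ⟨N.acyclic⟩
  have h : WellFounded (Relation.TransGen N.Adj) := Finite.wellFounded_of_trans_of_irrefl _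
  exact Subrelation.wf (fun h => Relation.TransGen.single h) h

/-- The inputs of a node `v` in a `(k, n)` code over `A`: the `k`-dimensional message vectors
originating at `v`, and the `n`-dimensional vectors carried by the incoming edges of `v`. -/
abbrev Inputs (k n : ℕ) (A : Type*) (v : N.Node) : Type _ :=
  ({x : N.Message // N.origin x = v} → Fin k → A) × ({e : N.Edge // N.tgt e = v} → Fin n → A)

/-- A `(k, n)` fractional code over `A`: an edge function for every edge, and a decoding function
for every demand of every receiver. -/
structure Code (k n : ℕ) (A : Type*) where
  edgeFn : ∀ e : N.Edge, N.Inputs k n A (N.src e) → Fin n → A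
  decode : ∀ (v : N.Node) (x : N.Message), x ∈ N.demands v → N.Inputs k n A v → Fin k → A

variable {N} {k n : ℕ} {A : Type*}

/-- The vector carried by each edge, given the values of all messages: the edge function is
applied to the inputs of the tail of the edge (recursively along the acyclic graph). -/
noncomputable def Code.edgeSymbol (C : N.Code k n A) (msg : N.Message → Fin k → A) :
    N.Edge → Fin n → A :=
  (InvImage.wf N.src N.wellFounded_adj).fix fun e rec =>
    C.edgeFn e ⟨fun x => msg x.1, fun e' => rec e'.1 ⟨e'.1, rfl, e'.2⟩⟩

/-- The inputs that the node `v` actually has, given the values of all messages. -/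
noncomputable def Code.inputsAt (C : N.Code k n A) (msg : N.Message → Fin k → A) (v : N.Node) :
    N.Inputs k n A v :=
  ⟨fun x => msg x.1, fun e => C.edgeSymbol msg e.1⟩

theorem Code.edgeSymbol_eq (C : N.Code k n A) (msg : N.Message → Fin k → A) (e : N.Edge) :
    C.edgeSymbol msg e = C.edgeFn e (C.inputsAt msg (N.src e)) := by
  unfold Code.edgeSymbol
  rw [WellFounded.fix_eq]
  rfl

/-- A `(k, n)` code is a solution if, for all values of the messages, every receiver recovers all
components of each of its demands. -/
def Code.IsSolution (C : N.Code k n A) : Prop :=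
  ∀ (msg : N.Message → Fin k → A) (v : N.Node) (x : N.Message) (hx : x ∈ N.demands v),
    C.decode v x hx (C.inputsAt msg v) = msg x

variable (N) (A)

/-- A network is solvable over `A` if it has a `(1, 1)` solution over `A`. -/
def SolvableOver : Prop := ∃ C : N.Code 1 1 A, C.IsSolution

/-- The disjoint union of a finite family of networks. -/
abbrev disjointUnion {ι : Type} [Finite ι] (F : ι → Network) : Network where
  Node := Σ i, (F i).Node
  Edge := Σ i, (F i).Edge
  Message := Σ i, (F i).Message
  finite_node := by
    have := fun i => (F i).finite_node
    infer_instance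
  finite_edge := by
    have := fun i => (F i).finite_edge
    infer_instance
  finite_message := by
    have := fun i => (F i).finite_message
    infer_instance
  src e := ⟨e.1, (F e.1).src e.2⟩
  tgt e := ⟨e.1, (F e.1).tgt e.2⟩
  acyclic := by
    have key : ∀ a b : (Σ i, (F i).Node),
        Relation.TransGen (fun a b => ∃ e : (Σ i, (F i).Edge),
          (⟨e.1, (F e.1).src e.2⟩ : Σ i, (F i).Node) = a ∧ ⟨e.1, (F e.1).tgt e.2⟩ = b) a b →
        ∃ h : a.1 = b.1, Relation.TransGen
          (fun c d => ∃ e, (F b.1).src e = c ∧ (F b.1).tgt e = d) (h ▸ a.2) b.2 := by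
      intro a b h
      induction h with
      | single h =>
        obtain ⟨e, rfl, rfl⟩ := h
        exact ⟨rfl, .single ⟨e.2, rfl, rfl⟩⟩
      | tail _ h ih =>
        obtain ⟨e, rfl, rfl⟩ := h
        obtain ⟨h', ih⟩ := ih
        exact ⟨h', ih.tail ⟨e.2, rfl, rfl⟩⟩
    intro v h
    obtain ⟨_, h⟩ := key v v h
    exact (F v.1).acyclic v.2 h
  origin x := ⟨x.1, (F x.1).origin x.2⟩
  demands v := {x | ∃ y ∈ (F v.1).demands v.2, x = ⟨v.1, y⟩}

end Network

/-! ### Networks built from blocks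

The block `B(m)` has message inputs `y 0, …, y m` and nodes `u i, v i, R i` (`i = 0, …, m`) and
`u, v`. The node `u i` receives every input except `y i` and has a single out-edge, to `v i`; the
node `u` receives every input and has a single out-edge, to `v`; the receiver `R i` has one
in-edge from `v i` and one from `v`, and demands `y i`; the `i`-th output edge of the block is an
out-edge of `v i`.

Below, `w` blocks `B(M 0), …, B(M (w - 1))` are put together with an additional receiver. -/

section Blocks

variable {w : ℕ} (M : Fin w → ℕ)

/-- The messages: the shared message `z`, and messages `x l j` for each block `l`, where
`j : Fin (M l)` stands for the index `j + 1` in `1, …, M l`. -/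
inductive BlockMessage : Type
  | z
  | x (l : Fin w) (j : Fin (M l))

/-- The message which is the `i`-th input of block `l`: input `0` is the shared message `z`, and
inputs `1, …, M l` are the own messages of the block. -/
def blockInput (l : Fin w) (i : Fin (M l + 1)) : BlockMessage M :=
  Fin.cases .z (fun j => .x l j) i

/-- The nodes: one source node for each message; `uAll l` and `vAll l` are the nodes
`u`, `v` of block `l`, and `u l i`, `v l i`, `R l i` its nodes `u i`, `v i`, `R i`; and `Rz` is
the additional receiver. -/
inductive BlockNode : Type
  | S (x : BlockMessage M)
  | u (l : Fin w) (i : Fin (M l + 1))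
  | uAll (l : Fin w)
  | v (l : Fin w) (i : Fin (M l + 1))
  | vAll (l : Fin w)
  | R (l : Fin w) (i : Fin (M l + 1))
  | Rz

variable (out : ∀ l : Fin w, Fin (M l + 1) → Prop)

/-- The edges. The output edge `i` of block `l` is an in-edge of the additional receiver if
`out l i` holds, and is absent (unused) otherwise. -/
inductive BlockEdge : Type
  /-- from the source of input `j` of block `l` to `u l i`, for `j ≠ i` -/
  | toU (l : Fin w) (i j : Fin (M l + 1)) (h : j ≠ i)
  /-- from the source of input `j` of block `l` to `uAll l` -/
  | toUAll (l : Fin w) (j : Fin (M l + 1))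
  /-- from `u l i` to `v l i`, carrying the edge symbol `e i` of block `l` -/
  | e (l : Fin w) (i : Fin (M l + 1))
  /-- from `uAll l` to `vAll l`, carrying the edge symbol `e` of block `l` -/
  | eAll (l : Fin w)
  /-- from `v l i` to `R l i` -/
  | vToR (l : Fin w) (i : Fin (M l + 1))
  /-- from `vAll l` to `R l i` -/
  | vAllToR (l : Fin w) (i : Fin (M l + 1))
  /-- output edge `i` of block `l`, from `v l i` to `Rz` -/
  | output (l : Fin w) (i : Fin (M l + 1)) (h : out l i)

instance finite_blockMessage : Finite (BlockMessage M) := by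
  let f : BlockMessage M → Unit ⊕ (Σ l : Fin w, Fin (M l)) := fun
    | .z => .inl ()
    | .x l j => .inr ⟨l, j⟩
  refine Finite.of_injective f ?_
  rintro (_ | _) (_ | _) h <;> simp_all [f]

instance finite_blockNode : Finite (BlockNode M) := by
  let f : BlockNode M → BlockMessage M ⊕ (Fin 6 × Option (Fin w)) ×
      Option (Σ l : Fin w, Fin (M l + 1)) := fun
    | .S x => .inl x
    | .u l i => .inr ⟨(0, none), some ⟨l, i⟩⟩
    | .uAll l => .inr ⟨(1, some l), none⟩
    | .v l i => .inr ⟨(2, none), some ⟨l, i⟩⟩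
    | .vAll l => .inr ⟨(3, some l), none⟩
    | .R l i => .inr ⟨(4, none), some ⟨l, i⟩⟩
    | .Rz => .inr ⟨(5, none), none⟩
  refine Finite.of_injective f ?_
  rintro (_ | _ | _ | _ | _ | _ | _) (_ | _ | _ | _ | _ | _ | _) h <;> simp_all [f]

instance finite_blockEdge : Finite (BlockEdge M out) := by
  let f : BlockEdge M out → Fin 7 × Option (Fin w) ×
      Option (Σ l : Fin w, Fin (M l + 1)) × Option (Σ l : Fin w, Fin (M l + 1) × Fin (M l + 1)) :=
    fun
    | .toU l i j _ => ⟨0, none, none, some ⟨l, i, j⟩⟩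
    | .toUAll l j => ⟨1, none, some ⟨l, j⟩, none⟩
    | .e l i => ⟨2, none, some ⟨l, i⟩, none⟩
    | .eAll l => ⟨3, some l, none, none⟩
    | .vToR l i => ⟨4, none, some ⟨l, i⟩, none⟩
    | .vAllToR l i => ⟨5, none, some ⟨l, i⟩, none⟩
    | .output l i _ => ⟨6, none, some ⟨l, i⟩, none⟩
  refine Finite.of_injective f ?_
  rintro (⟨l, i, j, _⟩ | _ | _ | _ | _ | _ | ⟨l, i, _⟩)
    (⟨l', i', j', _⟩ | _ | _ | _ | _ | _ | ⟨l', i', _⟩) h <;> simp [f] at h <;>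
    (obtain ⟨rfl, h⟩ := h; simp_all)

/-- The tail of each edge. -/
def blockSrc : BlockEdge M out → BlockNode M
  | .toU l _ j _ => .S (blockInput M l j)
  | .toUAll l j => .S (blockInput M l j)
  | .e l i => .u l i
  | .eAll l => .uAll l
  | .vToR l i => .v l i
  | .vAllToR l _ => .vAll l
  | .output l i _ => .v l i

/-- The head of each edge. -/
def blockTgt : BlockEdge M out → BlockNode M
  | .toU l i _ _ => .u l i
  | .toUAll l _ => .uAll l
  | .e l i => .v l i
  | .eAll l => .vAll l
  | .vToR l i => .R l i
  | .vAllToR l i => .R l i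
  | .output _ _ _ => .Rz

/-- The layer of each node; every edge goes from a layer to a higher one. -/
def blockLayer : BlockNode M → ℕ
  | .S _ => 0
  | .u _ _ => 1
  | .uAll _ => 1
  | .v _ _ => 2
  | .vAll _ => 2
  | .R _ _ => 3
  | .Rz => 3

theorem blockLayer_lt (a b : BlockNode M)
    (h : Relation.TransGen (fun a b => ∃ e, blockSrc M out e = a ∧ blockTgt M out e = b) a b) :
    blockLayer M a < blockLayer M b := by
  have step : ∀ e, blockLayer M (blockSrc M out e) < blockLayer M (blockTgt M out e) := by
    rintro (_ | _ | _ | _ | _ | _ | _) <;> simp [blockSrc, blockTgt, blockLayer]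
  induction h with
  | single h => obtain ⟨e, rfl, rfl⟩ := h; exact step e
  | tail _ h ih => obtain ⟨e, rfl, rfl⟩ := h; exact ih.trans (step e)

/-- The network made of the blocks `B(M l)`, for `l : Fin w`, sharing the message `z` as their
input `0`, together with a source node for every message and one additional receiver `Rz`, which
receives the output edges selected by `out` and demands `z`. -/
abbrev blockNetwork : Network where
  Node := BlockNode M
  Edge := BlockEdge M out
  Message := BlockMessage M
  finite_node := inferInstance
  finite_edge := inferInstance
  finite_message := inferInstance
  src := blockSrc M out
  tgt := blockTgt M out
  acyclic := fun v h => lt_irrefl _ (blockLayer_lt M out v v h)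
  origin := .S
  demands
    | .R l i => {blockInput M l i}
    | .Rz => {.z}
    | _ => ∅

end Blocks

/-- The network `N₁(m)`: a single block `B(m)`, whose inputs are the messages `x 0, …, x m`, and
an additional receiver, which receives all the output edges of the block and demands `x 0`
(which is the message `z` of `blockNetwork`). -/
abbrev N1 (m : ℕ) : Network := blockNetwork (fun _ : Fin 1 => m) (fun _ _ => True)

/-- The network `N₂(m, w)`: `w` blocks `B(m + 1)`, with the shared message `z` as their input `0`,
and an additional receiver, which receives all output edges of all blocks, except the `0`-th one
of each block, and demands `z`. -/
abbrev N2 (m w : ℕ) : Network := blockNetwork (fun _ : Fin w => m + 1) (fun _ i => i ≠ 0)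

/-- The network `N₃(m₁, m₂)`: blocks `B(m₁)` and `B(m₂)`, with the shared message `z` as their
input `0`, and an additional receiver, which receives all output edges of both blocks and
demands `z`. -/
abbrev N3 (m₁ m₂ : ℕ) : Network := blockNetwork ![m₁, m₂] (fun _ _ => True)

/-! ### The network `N₄(m)`

The prime factors of `m` are indexed by themselves; the exponent of `p` is
`m.factorization p`. -/

/-- `f(m) = ∏ p ^ (γ_p - 1)` over the prime factors `p` of `m`, of exponent `γ_p`. -/
def f (m : ℕ) : ℕ := ∏ p ∈ m.primeFactors, p ^ (m.factorization p - 1)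

/-- `μ(m, p) = min {α ≥ 0 : p ^ α ≥ f(m)}`. -/
noncomputable def mu (m p : ℕ) : ℕ := sInf {α : ℕ | f m ≤ p ^ α}

/-- `g(m, p) = p ^ (γ_p - 1) * ∏ r ^ μ(m, r)`, over the prime factors `r ≠ p` of `m`. -/
noncomputable def g (m p : ℕ) : ℕ :=
  p ^ (m.factorization p - 1) * ∏ r ∈ m.primeFactors.erase p, r ^ mu m r

/-- The primes `q < f(m)` which do not divide `m`. -/
abbrev Index1 (m : ℕ) : Type := {q : Fin (f m) // (q : ℕ).Prime ∧ ¬ (q : ℕ) ∣ m}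

/-- The prime factors of `m`. -/
abbrev Index2 (m : ℕ) : Type := {p : ℕ // p ∈ m.primeFactors}

/-- The prime factors of `m` of exponent greater than `1`. -/
abbrev Index3 (m : ℕ) : Type := {p : Index2 m // 1 < m.factorization p}

/-- The network `N₄(m)`: the disjoint union of
* `N₁(q)`, for the primes `q < f(m)` not dividing `m`,
* `N₂(p ^ γ_p, m / p ^ γ_p)`, for the prime factors `p` of `m`, of exponent `γ_p`,
* `N₃(p, g(m, p))`, for the prime factors `p` of `m` with `γ_p > 1`. -/
noncomputable abbrev N4 (m : ℕ) : Network :=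
  Network.disjointUnion (ι := Index1 m ⊕ Index2 m ⊕ Index3 m) <|
    Sum.elim (fun q => N1 q.1) <|
      Sum.elim (fun p => N2 (p ^ m.factorization p) (m / p ^ m.factorization p))
        (fun p => N3 p.1 (g m p.1))

end NetworkCoding

/-! Let `n = |A|`. A solved block forces an abelian group structure on `A`: after permuting each
input alphabet, the symbol on the edge from `u i` to `v i` depends only on the sum of the inputs
other than the `i`-th (`exists_addCommGroup_of_block`). Different blocks may induce different
groups, but all have order `n`, so divisibility properties of `n` are common to them.

The additional receiver is then defeated by a compensating shift: change `z` so that its permuted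
value moves by `d`, and move every other permuted input of the block by `s`. In `B(M)` output `0`
sees the change `M • s` and every other output sees `d + (M - 1) • s`. Distinct values of `z` for
which all visible changes vanish contradict the demand. This gives three constraints: `N1 q` forces
`q ∤ n`, `N2 (p ^ k) w` forces `p ∣ n`, and `N3 p g` with `p ∣ n` forces `n ∤ g`.

The bound `m ≤ n` then follows by arithmetic (`le_of_not_dvd_g`), based on `m = f m * rad m`, where
`rad m` is the product of the primes dividing `m`. -/

namespace NetworkCoding

open Function Finset

/-! ### Determinacy of edge symbols -/

namespace Network

/-- The family `σ` of edge symbols, as functions of the messages, comes from a solution: the symbol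
of an edge is determined by the inputs of its tail, and a demand by the inputs of its receiver. -/
structure IsSymbolFamily (N : Network) {A : Type*} (σ : (N.Message → A) → N.Edge → A) : Prop where
  edge : ∀ (e : N.Edge) (s t : N.Message → A), (∀ x, N.origin x = N.src e → s x = t x) →
    (∀ e', N.tgt e' = N.src e → σ s e' = σ t e') → σ s e = σ t e
  demand : ∀ (v : N.Node) (x : N.Message) (s t : N.Message → A), x ∈ N.demands v →
    (∀ y, N.origin y = v → s y = t y) → (∀ e, N.tgt e = v → σ s e = σ t e) → s x = t x

theorem SolvableOver.exists_isSymbolFamily {N : Network} {A : Type*} (h : N.SolvableOver A) :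
    ∃ σ : (N.Message → A) → N.Edge → A, N.IsSymbolFamily σ := by
  obtain ⟨C, hC⟩ := h
  have inputs : ∀ (v : N.Node) (s t : N.Message → A), (∀ x, N.origin x = v → s x = t x) →
      (∀ e, N.tgt e = v →
        C.edgeSymbol (fun x _ => s x) e 0 = C.edgeSymbol (fun x _ => t x) e 0) →
      C.inputsAt (fun x _ => s x) v = C.inputsAt (fun x _ => t x) v := by
    intro v s t hx he
    refine Prod.ext ?_ ?_
    · funext x k
      exact hx x.1 x.2
    · funext e k
      rw [Subsingleton.elim k 0]
      exact he e.1 e.2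
  refine ⟨fun s e => C.edgeSymbol (fun x _ => s x) e 0, ⟨fun e s t hx he => ?_,
    fun v x s t hd hx he => ?_⟩⟩
  · rw [C.edgeSymbol_eq, C.edgeSymbol_eq, inputs _ s t hx he]
  · have h1 := hC (fun x _ => s x) v x hd
    rw [inputs v s t hx he, hC (fun x _ => t x) v x hd] at h1
    exact (congrFun h1 0).symm

theorem IsSymbolFamily.component {ι : Type} [Finite ι] {F : ι → Network} {A : Type*} [Nonempty A]
    {σ : ((disjointUnion F).Message → A) → (disjointUnion F).Edge → A}
    (h : (disjointUnion F).IsSymbolFamily σ) (i : ι) :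
    ∃ τ : ((F i).Message → A) → (F i).Edge → A, (F i).IsSymbolFamily τ := by
  obtain ⟨c⟩ := ‹Nonempty A›
  -- Messages of the other components are frozen at `c`; no edge joins two components.
  let ext : ((F i).Message → A) → (disjointUnion F).Message → A :=
    fun s => extend (Sigma.mk i) s (fun _ => c)
  have ext_mk : ∀ s x, ext s ⟨i, x⟩ = s x := fun s x => sigma_mk_injective.extend_apply _ _ _
  refine ⟨fun s e => σ (ext s) ⟨i, e⟩, ⟨fun e s t hx he => ?_, fun v x s t hd hx he => ?_⟩⟩
  · refine h.edge ⟨i, e⟩ _ _ ?_ ?_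
    · rintro ⟨j, y⟩ hj
      obtain ⟨rfl, hj⟩ := Sigma.mk.inj_iff.1 hj
      rw [ext_mk, ext_mk, hx y (eq_of_heq hj)]
    · rintro ⟨j, e'⟩ hj
      obtain ⟨rfl, hj⟩ := Sigma.mk.inj_iff.1 hj
      exact he e' (eq_of_heq hj)
  · rw [← ext_mk s, ← ext_mk t]
    refine h.demand ⟨i, v⟩ ⟨i, x⟩ _ _ ⟨x, hd, rfl⟩ ?_ ?_
    · rintro ⟨j, y⟩ hj
      obtain ⟨rfl, hj⟩ := Sigma.mk.inj_iff.1 hj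
      rw [ext_mk, ext_mk, hx y (eq_of_heq hj)]
    · rintro ⟨j, e'⟩ hj
      obtain ⟨rfl, hj⟩ := Sigma.mk.inj_iff.1 hj
      exact he e' (eq_of_heq hj)

end Network

/-! ### The abelian group carried by a block -/

section BlockGroup

variable {ι A : Type*} [DecidableEq ι]

/-- By `star`, a tuple can be replaced by any other with the same `H`-value and the same `i`-th
entry before that entry is changed. Hence filling in one more coordinate is a binary operation on
the value so far, and three coordinates suffice to make this operation commutative and associative.
-/
theorem exists_addCommGroup_of_normalized [Fintype ι] [Finite A] {i₀ i₁ i₂ : ι} (h01 : i₀ ≠ i₁)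
    (h02 : i₀ ≠ i₂) (h12 : i₁ ≠ i₂) (H : (ι → A) → A) (o : A)
    (inj : ∀ x i, Injective fun a => H (update x i a))
    (unit : ∀ i a, H (update (fun _ => o) i a) = a)
    (star : ∀ i x y a, x i = y i → H x = H y → H (update x i a) = H (update y i a)) :
    ∃ _ : AddCommGroup A, (0 : A) = o ∧ ∀ x, H x = ∑ i, x i := by
  let op : ι → ι → A → A → A := fun i k a b => H (update (update (fun _ => o) i a) k b)
  have op_comm : ∀ i k a b, i ≠ k → op i k a b = op k i b a := fun i k a b hik => by
    simp only [op, update_comm hik]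
  -- Here `x` is replaced by the tuple with `H x` in position `k` and `o` elsewhere, which has the
  -- same `H`-value by `unit`.
  have key : ∀ x i k a, x i = o → k ≠ i → H (update x i a) = op k i (H x) a := by
    intro x i k a hx hk
    refine star i _ _ a ?_ ?_
    · rw [hx, update_of_ne hk.symm]
    · rw [unit]
  have op_left : ∀ i k k' a b, k ≠ i → k' ≠ i → op k i a b = op k' i a b := by
    intro i k k' a b hk hk'
    have := key (update (fun _ => o) k a) i k' b (update_of_ne hk.symm _ _) hk'
    rwa [unit] at this
  let ad : A → A → A := op i₀ i₁
  -- The two arguments trade places by moving one at a time through the third, free position.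
  have ad_comm : ∀ a b, ad a b = ad b a := by
    intro a b
    calc op i₀ i₁ a b = op i₂ i₁ a b := op_left _ _ _ _ _ h01 h12.symm
      _ = op i₁ i₂ b a := op_comm _ _ _ _ h12.symm
      _ = op i₀ i₂ b a := op_left _ _ _ _ _ h12 h02
      _ = op i₂ i₀ a b := op_comm _ _ _ _ h02
      _ = op i₁ i₀ a b := op_left _ _ _ _ _ h02.symm h01.symm
      _ = op i₀ i₁ b a := op_comm _ _ _ _ h01.symm
  have op_eq : ∀ i k a b, k ≠ i → op k i a b = ad a b := by
    intro i k a b hk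
    by_cases hi : i = i₁
    · subst hi
      exact op_left _ _ _ _ _ hk h01
    · rw [op_left i k i₁ a b hk (Ne.symm hi), op_comm _ _ _ _ (Ne.symm hi),
        op_left i₁ i i₀ b a hi h01]
      exact ad_comm b a
  have upd : ∀ x i a, x i = o → H (update x i a) = ad (H x) a := by
    intro x i a hx
    obtain ⟨k, hk⟩ : ∃ k, k ≠ i := by
      by_cases hi : i₀ = i
      · exact ⟨i₁, hi ▸ h01.symm⟩
      · exact ⟨i₀, hi⟩
    rw [key x i k a hx hk, op_eq i k _ _ hk]
  have H_const : H (fun _ => o) = o := by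
    have := unit i₀ o
    rwa [update_eq_self_iff.2 rfl] at this
  have ad_zero : ∀ a, ad a o = a := by
    intro a
    have : update (update (fun _ => o) i₀ a) i₁ o = update (fun _ => o) i₀ a :=
      update_eq_self_iff.2 (update_of_ne h01.symm a fun _ => o).symm
    simp only [ad, op, this, unit]
  -- One tuple with three entries is evaluated in two orders of filling.
  have ad_assoc : ∀ a b c, ad (ad a b) c = ad a (ad b c) := by
    intro a b c
    have e1 : H (update (update (update (fun _ => o) i₀ a) i₁ b) i₂ c) = ad (ad a b) c := by
      rw [upd _ _ _ (by rw [update_of_ne h12.symm, update_of_ne h02.symm]),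
        upd _ _ _ (by rw [update_of_ne h01.symm]), unit]
    have e2 : H (update (update (update (fun _ => o) i₁ b) i₂ c) i₀ a) = ad (ad b c) a := by
      rw [upd _ _ _ (by rw [update_of_ne h02, update_of_ne h01]),
        upd _ _ _ (by rw [update_of_ne h12.symm]), unit]
    rw [← e1, ad_comm a, ← e2, update_comm h01, update_comm h02]
  have ex_neg : ∀ a, ∃ b, ad b a = o := by
    intro a
    obtain ⟨b, hb⟩ := Finite.surjective_of_injective (inj (update (fun _ => o) i₀ a) i₁) o
    exact ⟨b, (ad_comm b a).trans hb⟩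
  choose ng h_ng using ex_neg
  let : Add A := ⟨ad⟩
  let : Zero A := ⟨o⟩
  let : Neg A := ⟨ng⟩
  let G : AddCommGroup A :=
    { add := ad
      zero := o
      neg := ng
      add_assoc := ad_assoc
      zero_add := fun a => (ad_comm o a).trans (ad_zero a)
      add_zero := ad_zero
      neg_add_cancel := h_ng
      add_comm := ad_comm
      nsmul := nsmulRec
      zsmul := zsmulRec }
  refine ⟨G, rfl, fun x => ?_⟩
  have sum : ∀ s : Finset ι, H (s.piecewise x fun _ => o) = ∑ i ∈ s, x i := by
    intro s
    induction s using Finset.induction_on with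
    | empty => rw [piecewise_empty, H_const, sum_empty]; rfl
    | insert i s hi ih =>
      rw [piecewise_insert, upd _ _ _ (piecewise_eq_of_notMem _ _ _ hi), ih, sum_insert hi,
        add_comm]
      rfl
  simpa using sum univ

/-- If `E` and the `e i` (where `e i` does not depend on `y i`) determine together every `y i`, then
up to permutations of the inputs, `e i` is determined by a sum, in an abelian group, of the inputs
other than `y i`. -/
theorem exists_addCommGroup_of_block [Fintype ι] [Finite A] [Nonempty A] {i₀ i₁ i₂ : ι}
    (h01 : i₀ ≠ i₁) (h02 : i₀ ≠ i₂) (h12 : i₁ ≠ i₂) (E : (ι → A) → A) (e : ι → (ι → A) → A)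
    (indep : ∀ i x y, (∀ j, j ≠ i → x j = y j) → e i x = e i y)
    (decode : ∀ i x y, e i x = e i y → E x = E y → x i = y i) :
    ∃ (_ : AddCommGroup A) (π : ι → Equiv.Perm A), ∀ i x y,
      ∑ j ∈ univ.erase i, π j (x j) = ∑ j ∈ univ.erase i, π j (y j) → e i x = e i y := by
  obtain ⟨c⟩ := ‹Nonempty A›
  have e_upd : ∀ i x a, e i (update x i a) = e i x := fun i x a =>
    indep i _ _ fun j hj => update_of_ne hj _ _
  have inj : ∀ x i, Injective fun a => E (update x i a) := by
    intro x i a b hab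
    have := decode i (update x i a) (update x i b) (by rw [e_upd, e_upd]) hab
    rwa [update_self, update_self] at this
  have bij : ∀ x i, Bijective fun a => E (update x i a) := fun x i =>
    Finite.injective_iff_bijective.1 (inj x i)
  -- The `i`-th entry of `x` can be adjusted to reach the value `E y` without affecting `e i`;
  -- decoding shows that the adjustment was void.
  have E_eq : ∀ i x y, x i = y i → e i x = e i y → E x = E y := by
    intro i x y hi he
    obtain ⟨a, ha⟩ := (bij x i).2 (E y)
    have := decode i (update x i a) y (by rw [e_upd, he]) ha
    rw [update_self, ← hi] at this
    simpa [this] using ha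
  -- The converse uses finiteness: varying another coordinate `k` makes `e i` run bijectively
  -- through `A`, and `E_eq` pins down the matching value. With the `i`-th input fixed, `e i` and
  -- `E` thus determine each other.
  have e_eq : ∀ i x y, x i = y i → E x = E y → e i x = e i y := by
    intro i x y hi hE
    obtain ⟨k, hk⟩ : ∃ k, k ≠ i := by
      by_cases hi : i₀ = i
      · exact ⟨i₁, hi ▸ h01.symm⟩
      · exact ⟨i₀, hi⟩
    have e_inj : Injective fun a => e i (update x k a) := fun a b hab =>
      inj x k (E_eq i _ _ (by rw [update_of_ne hk.symm, update_of_ne hk.symm]) hab)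
    obtain ⟨a, ha⟩ := Finite.surjective_of_injective e_inj (e i y)
    have h1 := E_eq i (update x k a) y (by rw [update_of_ne hk.symm, hi]) ha
    rw [← hE] at h1
    have h2 : a = x k := inj x k (by simpa using h1)
    simpa [h2] using ha
  -- Relabelling each input by its effect on `E` at the constant tuple `c` yields the isotope `H` of
  -- `E`, with neutral element `E (c, …, c)`.
  let α : ι → Equiv.Perm A := fun i => Equiv.ofBijective _ (bij (fun _ => c) i)
  have α_apply : ∀ i a, α i a = E (update (fun _ => c) i a) := fun _ _ => rfl
  have α_c : ∀ i, α i c = E fun _ => c := fun i => by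
    rw [α_apply, update_eq_self_iff.2 rfl]
  let H : (ι → A) → A := fun x => E fun i => (α i).symm (x i)
  have H_upd : ∀ x i a, H (update x i a) =
      E (update (fun i => (α i).symm (x i)) i ((α i).symm a)) := by
    intro x i a
    refine congrArg E (funext fun j => ?_)
    by_cases hj : j = i
    · subst hj; simp
    · simp [update_of_ne hj]
  obtain ⟨G, h0, hH⟩ := exists_addCommGroup_of_normalized h01 h02 h12 H (E fun _ => c)
    (fun x i a b hab => by
      simp only [H_upd] at hab
      exact (α i).symm.injective (inj _ i hab))
    (fun i a => by
      have : (fun i => (α i).symm (E fun _ => c)) = fun _ => c :=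
        funext fun i => (Equiv.symm_apply_eq _).2 (α_c i).symm
      rw [H_upd, this, ← α_apply, Equiv.apply_symm_apply])
    (fun i x y a hi hxy => by
      rw [H_upd, H_upd]
      refine E_eq i _ _ (by rw [update_self, update_self]) ?_
      rw [e_upd, e_upd]
      exact e_eq i _ _ (by rw [hi]) hxy)
  refine ⟨G, α, fun i x y hxy => ?_⟩
  -- Since `α i c` is the zero of the group, setting the `i`-th input to `c` removes its term; `e i`
  -- does not notice.
  have sum : ∀ x : ι → A, E (update x i c) = ∑ j ∈ univ.erase i, α j (x j) := by
    intro x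
    have h1 : E (update x i c) = H fun j => α j (update x i c j) := by simp [H]
    rw [h1, hH, ← add_sum_erase _ _ (mem_univ i), update_self, α_c, ← h0, zero_add]
    exact sum_congr rfl fun j hj => by rw [update_of_ne (ne_of_mem_erase hj)]
  rw [← e_upd i x c, ← e_upd i y c]
  exact e_eq i _ _ (by rw [update_self, update_self]) (by rw [sum, sum, hxy])

end BlockGroup

/-! ### Networks built from blocks -/

section Blocks

variable {w : ℕ} {M : Fin w → ℕ} {out : ∀ l : Fin w, Fin (M l + 1) → Prop}

theorem blockInput_injective (l : Fin w) : Injective (blockInput M l) := by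
  intro i j h
  cases i using Fin.cases <;> cases j using Fin.cases <;> simp_all [blockInput]

variable {A : Type*} {σ : (BlockMessage M → A) → BlockEdge M out → A}

theorem symbol_toU (hσ : (blockNetwork M out).IsSymbolFamily σ) (l : Fin w) (i j : Fin (M l + 1))
    (hj : j ≠ i) (s t : BlockMessage M → A) (h : s (blockInput M l j) = t (blockInput M l j)) :
    σ s (.toU l i j hj) = σ t (.toU l i j hj) := by
  refine hσ.edge _ s t (fun x hx => ?_) (fun e he => ?_)
  · cases hx; exact h
  · cases e <;> cases he

theorem symbol_toUAll (hσ : (blockNetwork M out).IsSymbolFamily σ) (l : Fin w) (j : Fin (M l + 1))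
    (s t : BlockMessage M → A) (h : s (blockInput M l j) = t (blockInput M l j)) :
    σ s (.toUAll l j) = σ t (.toUAll l j) := by
  refine hσ.edge _ s t (fun x hx => ?_) (fun e he => ?_)
  · cases hx; exact h
  · cases e <;> cases he

theorem symbol_e (hσ : (blockNetwork M out).IsSymbolFamily σ) (l : Fin w) (i : Fin (M l + 1))
    (s t : BlockMessage M → A)
    (h : ∀ j, j ≠ i → s (blockInput M l j) = t (blockInput M l j)) :
    σ s (.e l i) = σ t (.e l i) := by
  refine hσ.edge _ s t (fun x hx => by cases hx) (fun e he => ?_)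
  cases e <;> cases he
  exact symbol_toU hσ _ _ _ _ s t (h _ ‹_›)

theorem symbol_eAll (hσ : (blockNetwork M out).IsSymbolFamily σ) (l : Fin w)
    (s t : BlockMessage M → A) (h : ∀ j, s (blockInput M l j) = t (blockInput M l j)) :
    σ s (.eAll l) = σ t (.eAll l) := by
  refine hσ.edge _ s t (fun x hx => by cases hx) (fun e he => ?_)
  cases e <;> cases he
  exact symbol_toUAll hσ _ _ s t (h _)

theorem eq_of_symbol_e_eAll (hσ : (blockNetwork M out).IsSymbolFamily σ) (l : Fin w)
    (i : Fin (M l + 1)) (s t : BlockMessage M → A) (he : σ s (.e l i) = σ t (.e l i))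
    (hE : σ s (.eAll l) = σ t (.eAll l)) : s (blockInput M l i) = t (blockInput M l i) := by
  refine hσ.demand (.R l i) _ s t rfl (fun x hx => by cases hx) (fun e h => ?_)
  cases e <;> cases h
  · refine hσ.edge _ s t (fun x hx => by cases hx) (fun e h => ?_)
    cases e <;> cases h
    exact he
  · refine hσ.edge _ s t (fun x hx => by cases hx) (fun e h => ?_)
    cases e <;> cases h
    exact hE

theorem eq_of_symbol_output (hσ : (blockNetwork M out).IsSymbolFamily σ)
    (s t : BlockMessage M → A) (h : ∀ l i, out l i → σ s (.e l i) = σ t (.e l i)) :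
    s .z = t .z := by
  refine hσ.demand .Rz _ s t rfl (fun x hx => by cases hx) (fun e he => ?_)
  cases e <;> cases he
  rename_i hout
  refine hσ.edge _ s t (fun x hx => by cases hx) (fun e he => ?_)
  cases e <;> cases he
  exact h _ _ hout

theorem exists_addCommGroup_symbol [Finite A] [Nonempty A]
    (hσ : (blockNetwork M out).IsSymbolFamily σ) (l : Fin w) (hM : 2 ≤ M l) :
    ∃ (_ : AddCommGroup A) (π : Fin (M l + 1) → Equiv.Perm A), ∀ i s t,
      ∑ j ∈ univ.erase i, π j (s (blockInput M l j)) =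
        ∑ j ∈ univ.erase i, π j (t (blockInput M l j)) → σ s (.e l i) = σ t (.e l i) := by
  obtain ⟨c⟩ := ‹Nonempty A›
  have : Nonempty A := ⟨c⟩
  let ext : (Fin (M l + 1) → A) → BlockMessage M → A :=
    fun y => extend (blockInput M l) y fun _ => c
  have ext_apply : ∀ y j, ext y (blockInput M l j) = y j := fun y j =>
    (blockInput_injective l).extend_apply _ _ _
  obtain ⟨G, π, h⟩ := exists_addCommGroup_of_block (A := A)
    (i₀ := (⟨0, by omega⟩ : Fin (M l + 1))) (i₁ := ⟨1, by omega⟩) (i₂ := ⟨2, by omega⟩)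
    (by simp) (by simp) (by simp) (fun y => σ (ext y) (.eAll l)) (fun i y => σ (ext y) (.e l i))
    (fun i x y hxy => symbol_e hσ l i _ _ fun j hj => by rw [ext_apply, ext_apply, hxy j hj])
    (fun i x y he hE => by simpa [ext_apply] using eq_of_symbol_e_eAll hσ l i _ _ he hE)
  refine ⟨G, π, fun i s t hst => ?_⟩
  have h1 : ∀ s : BlockMessage M → A,
      σ s (.e l i) = σ (ext fun j => s (blockInput M l j)) (.e l i) := fun s =>
    symbol_e hσ l i _ _ fun j _ => by rw [ext_apply]
  rw [h1 s, h1 t]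
  exact h i _ _ hst

/-- This is the change seen at output `i` when the permuted shared input moves by `d` and the others
by `s`. -/
theorem sum_erase_cases {G : Type*} [AddCommGroup G] {n : ℕ} (i : Fin (n + 1)) (d s : G) :
    ∑ j ∈ univ.erase i, (Fin.cases d (fun _ => s) j : G) =
      if i = 0 then n • s else d + n • s - s := by
  rw [eq_sub_of_add_eq' (add_sum_erase univ (fun j => (Fin.cases d (fun _ => s) j : G))
    (mem_univ i)), Fin.sum_univ_succ]
  cases i using Fin.cases <;> simp

/-- Two values of the shared message cannot be distinguished by the additional receiver if, in every
block, their difference can be compensated by a common shift of the other inputs. -/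
theorem exists_addCommGroup_eq_of_compensated [Finite A] [Nonempty A]
    (hσ : (blockNetwork M out).IsSymbolFamily σ) (hM : ∀ l, 2 ≤ M l) :
    ∃ (G : Fin w → AddCommGroup A) (π : Fin w → Equiv.Perm A), ∀ a b : A,
      (∀ l, letI := G l; ∃ s : A, ∀ i, out l i →
        (if i = 0 then M l • s else (π l b - π l a) + M l • s - s) = 0) → a = b := by
  choose G π h using fun l => exists_addCommGroup_symbol hσ l (hM l)
  refine ⟨G, fun l => π l 0, fun a b hab => ?_⟩
  choose s hs using hab
  obtain ⟨c⟩ := ‹Nonempty A›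
  -- Two message assignments to be confused: `z` passes from `a` to `b`, and in block `l` each own
  -- message moves by `s l` after its permutation, in the group of that block.
  let u : BlockMessage M → A
    | .z => a
    | .x _ _ => c
  let v : BlockMessage M → A
    | .z => b
    | .x l j => letI := G l; (π l j.succ).symm (π l j.succ c + s l)
  refine eq_of_symbol_output hσ u v fun l i hi => h l i u v ?_
  let := G l
  have hv : ∀ j, π l j (v (blockInput M l j)) = π l j (u (blockInput M l j)) +
      (Fin.cases (π l 0 b - π l 0 a) (fun _ => s l) j : A) := by
    intro j
    cases j using Fin.cases <;> simp [blockInput, u, v]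
  have h0 := hs l i hi
  simp only [hv, sum_add_distrib, sum_erase_cases]
  rw [h0, add_zero]

end Blocks

/-! ### The three kinds of components -/

section Components

variable {A : Type*} [Finite A]

/-- By Cauchy there is an element of order `p`; pulling it and `0` back through `π` gives the pair.
-/
theorem exists_ne_nsmul_sub_eq_zero [AddCommGroup A] (π : Equiv.Perm A) {p : ℕ} (hp : p.Prime)
    (h : p ∣ Nat.card A) : ∃ a b : A, a ≠ b ∧ p • (π b - π a) = 0 := by
  have := Fact.mk hp
  obtain ⟨t, ht⟩ := exists_prime_addOrderOf_dvd_card' p h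
  refine ⟨π.symm 0, π.symm t, fun h0 => ?_, by simp [← ht]⟩
  obtain rfl := π.symm.injective h0
  rw [addOrderOf_zero] at ht
  exact hp.one_lt.ne ht

/-- When `n • d = 0`, the shift `s = d` compensates at every output at once. -/
theorem ite_nsmul_eq_zero {G : Type*} [AddCommGroup G] {P : Prop} [Decidable P] {n : ℕ} {d : G}
    (h : n • d = 0) : (if P then n • d else d + n • d - d) = 0 := by
  simp [h]

theorem not_dvd_card_of_N1 [Nontrivial A] {q : ℕ} (hq : q.Prime)
    {σ : ((N1 q).Message → A) → (N1 q).Edge → A} (hσ : (N1 q).IsSymbolFamily σ) :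
    ¬ q ∣ Nat.card A := by
  intro hdvd
  obtain ⟨G, π, h⟩ := exists_addCommGroup_eq_of_compensated hσ fun _ => hq.two_le
  obtain ⟨a, b, hab, hq0⟩ := @exists_ne_nsmul_sub_eq_zero A _ (G 0) (π 0) q hq hdvd
  refine hab (h a b fun l => ?_)
  obtain rfl := Subsingleton.elim 0 l
  exact ⟨_, fun i _ => @ite_nsmul_eq_zero A (G 0) _ _ _ _ hq0⟩

theorem dvd_card_of_N2 [Nontrivial A] {p k w : ℕ} (hp : p.Prime)
    {σ : ((N2 (p ^ k) w).Message → A) → (N2 (p ^ k) w).Edge → A}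
    (hσ : (N2 (p ^ k) w).IsSymbolFamily σ) : p ∣ Nat.card A := by
  by_contra hdvd
  obtain ⟨G, π, h⟩ := exists_addCommGroup_eq_of_compensated hσ fun _ =>
    Nat.succ_le_succ (Nat.one_le_pow _ _ hp.pos)
  obtain ⟨a, b, hab⟩ := exists_pair_ne A
  refine hab (h a b fun l => ?_)
  let := G l
  have hco : (Nat.card A).Coprime (p ^ k) := ((hp.coprime_iff_not_dvd.2 hdvd).pow_left k).symm
  -- Output `0` is not visible and the block is `B(p ^ k + 1)`, so the only condition is `d + p ^ k
  -- • s = 0`, solvable because `p ^ k` is invertible on a group of order prime to `p`.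
  obtain ⟨s, hs⟩ := (nsmulCoprime hco).surjective (π l a - π l b)
  refine ⟨s, fun i hi => ?_⟩
  have hs' : p ^ k • s = π l a - π l b := hs
  rw [if_neg hi, succ_nsmul, hs']
  abel

theorem not_card_dvd_of_N3 [Nontrivial A] {p g : ℕ} (hp : p.Prime) (hg : 2 ≤ g)
    {σ : ((N3 p g).Message → A) → (N3 p g).Edge → A} (hσ : (N3 p g).IsSymbolFamily σ)
    (hdvd : p ∣ Nat.card A) : ¬ Nat.card A ∣ g := by
  rintro ⟨r, hr⟩
  obtain ⟨G, π, h⟩ := exists_addCommGroup_eq_of_compensated hσ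
    (Fin.forall_fin_two.2 ⟨hp.two_le, hg⟩)
  obtain ⟨a, b, hab, hp0⟩ := @exists_ne_nsmul_sub_eq_zero A _ (G 0) (π 0) p hp hdvd
  -- The pair is chosen to have difference of order `p` in the first group; in the second, `g` is a
  -- multiple of `|A|` and kills any difference.
  have killed : ∀ l, letI := G l; (![p, g] l) • (π l b - π l a) = 0 := by
    refine Fin.forall_fin_two.2 ⟨hp0, ?_⟩
    let := G 1
    change g • (π 1 b - π 1 a) = 0
    rw [hr, mul_comm, mul_nsmul', card_nsmul_eq_zero', nsmul_zero]
  exact hab (h a b fun l => ⟨_, fun i _ =>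
    @ite_nsmul_eq_zero A (G l) _ _ _ _ (killed l)⟩)

end Components

/-! ### Arithmetic -/

section Arithmetic

theorem f_mul_prod_primeFactors {m : ℕ} (hm : m ≠ 0) : f m * ∏ p ∈ m.primeFactors, p = m := by
  rw [f, ← prod_mul_distrib]
  conv_rhs => rw [← Nat.prod_factorization_pow_eq_self hm]
  refine prod_congr rfl fun p hp => ?_
  rw [← pow_succ, Nat.sub_add_cancel]
  exact (Nat.prime_of_mem_primeFactors hp).factorization_pos_of_dvd hm
    (Nat.dvd_of_mem_primeFactors hp)

theorem f_le_pow_mu {m p : ℕ} (hp : p.Prime) : f m ≤ p ^ mu m p :=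
  Nat.sInf_mem (s := {α : ℕ | f m ≤ p ^ α}) ⟨f m, (Nat.lt_pow_self hp.one_lt).le⟩

theorem two_le_g {m p : ℕ} (hp : p.Prime) (h : 1 < m.factorization p) : 2 ≤ g m p := by
  refine hp.two_le.trans (Nat.le_of_dvd ?_ ?_)
  · exact Nat.mul_pos (pow_pos hp.pos _) (prod_pos fun r hr =>
      pow_pos (Nat.prime_of_mem_primeFactors (mem_of_mem_erase hr)).pos _)
  · exact (dvd_pow_self p (by omega)).mul_right _

/-- Either `n` has a surplus factor of size at least `f m` beyond `rad m` (a prime `q ∤ m`, or `p ^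
mu m p`), so that `n ≥ f m * rad m = m`; or its exponents are bounded by `mu`, and then `m ∣ n`,
since a deficient exponent at `p` would make `n` divide `g m p`. -/
theorem le_of_not_dvd_g {m n : ℕ} (hm : m ≠ 0) (hn : n ≠ 0)
    (h1 : ∀ q, q.Prime → q < f m → ¬ q ∣ m → ¬ q ∣ n)
    (h2 : ∀ p ∈ m.primeFactors, p ∣ n)
    (h3 : ∀ p ∈ m.primeFactors, 1 < m.factorization p → ¬ n ∣ g m p) : m ≤ n := by
  have prime : ∀ p ∈ m.primeFactors, p.Prime := fun p => Nat.prime_of_mem_primeFactors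
  have hn0 : 0 < n := Nat.pos_of_ne_zero hn
  by_cases hq : ∃ q, q.Prime ∧ q ∣ n ∧ ¬ q ∣ m
  · obtain ⟨q, hq, hqn, hqm⟩ := hq
    have hle : f m ≤ q := not_lt.1 fun h => h1 q hq h hqm hqn
    have hdvd : q * ∏ p ∈ m.primeFactors, p ∣ n := by
      refine Nat.Coprime.mul_dvd_of_dvd_of_dvd (Nat.Coprime.prod_right fun p hp => ?_) hqn
        (prod_primes_dvd n (fun p hp => (prime p hp).prime) h2)
      exact (Nat.coprime_primes hq (prime p hp)).2 fun h =>
        hqm (h ▸ Nat.dvd_of_mem_primeFactors hp)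
    calc m = f m * ∏ p ∈ m.primeFactors, p := (f_mul_prod_primeFactors hm).symm
      _ ≤ q * ∏ p ∈ m.primeFactors, p := Nat.mul_le_mul_right _ hle
      _ ≤ n := Nat.le_of_dvd hn0 hdvd
  push Not at hq
  by_cases hmu : ∃ p ∈ m.primeFactors, mu m p < n.factorization p
  · obtain ⟨p, hp, hlt⟩ := hmu
    have hdvd : p ^ mu m p * ∏ p ∈ m.primeFactors, p ∣ n := by
      rw [← mul_prod_erase _ _ hp, ← mul_assoc, ← pow_succ]
      refine Nat.Coprime.mul_dvd_of_dvd_of_dvd (Nat.Coprime.prod_right fun r hr => ?_)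
        (((prime p hp).pow_dvd_iff_le_factorization hn).2 hlt) ?_
      · exact ((Nat.coprime_primes (prime p hp) (prime r (mem_of_mem_erase hr))).2
          (ne_of_mem_erase hr).symm).pow_left _
      · exact prod_primes_dvd n (fun r hr => (prime r (mem_of_mem_erase hr)).prime)
          fun r hr => h2 r (mem_of_mem_erase hr)
    calc m = f m * ∏ p ∈ m.primeFactors, p := (f_mul_prod_primeFactors hm).symm
      _ ≤ p ^ mu m p * ∏ p ∈ m.primeFactors, p :=
        Nat.mul_le_mul_right _ (f_le_pow_mu (prime p hp))
      _ ≤ n := Nat.le_of_dvd hn0 hdvd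
  push Not at hmu
  refine Nat.le_of_dvd hn0 ((Nat.factorization_prime_le_iff_dvd hm hn).1 fun p hp => ?_)
  by_contra! hlt
  have hpm : p ∈ m.primeFactors := Nat.support_factorization m ▸ Finsupp.mem_support_iff.2
    (by omega)
  have hpos := hp.factorization_pos_of_dvd hn (h2 p hpm)
  -- The exponent of `p` in `n` is at least `1` and smaller than that in `m`, so the latter exceeds
  -- `1`.
  refine h3 p hpm (by omega) ?_
  have hset : n.primeFactors = m.primeFactors := by
    ext q
    exact ⟨fun h => Nat.mem_primeFactors.2 ⟨Nat.prime_of_mem_primeFactors h,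
        hq q (Nat.prime_of_mem_primeFactors h) (Nat.dvd_of_mem_primeFactors h), hm⟩,
      fun h => Nat.mem_primeFactors.2 ⟨prime q h, h2 q h, hn⟩⟩
  rw [g]
  conv_lhs => rw [← Nat.prod_factorization_pow_eq_self hn]
  rw [Finsupp.prod, Nat.support_factorization, hset, ← mul_prod_erase _ _ hpm]
  exact Nat.mul_dvd_mul (pow_dvd_pow _ (by omega)) (prod_dvd_prod_of_dvd _ _ fun r hr =>
    pow_dvd_pow _ (hmu r (mem_of_mem_erase hr)))

end Arithmetic

end NetworkCoding

theorem theorem5p4 (m : ℕ) (hm : 2 ≤ m) (A : Type*) [Finite A] [Nontrivial A]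
    (h : (NetworkCoding.N4 m).SolvableOver A) : m ≤ Nat.card A := by
  obtain ⟨σ, hσ⟩ := h.exists_isSymbolFamily
  have hm0 : m ≠ 0 := by omega
  have h2 : ∀ p ∈ m.primeFactors, p ∣ Nat.card A := fun p hp => by
    obtain ⟨τ, hτ⟩ := hσ.component (Sum.inr (Sum.inl ⟨p, hp⟩))
    exact NetworkCoding.dvd_card_of_N2 (Nat.prime_of_mem_primeFactors hp) hτ
  refine NetworkCoding.le_of_not_dvd_g hm0 Nat.card_pos.ne' (fun q hq hlt hqm => ?_) h2
    (fun p hp hlt => ?_)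
  · obtain ⟨τ, hτ⟩ := hσ.component (Sum.inl ⟨⟨q, hlt⟩, hq, hqm⟩)
    exact NetworkCoding.not_dvd_card_of_N1 hq hτ
  · have hpp := Nat.prime_of_mem_primeFactors hp
    obtain ⟨τ, hτ⟩ := hσ.component (Sum.inr (Sum.inr ⟨⟨p, hp⟩, hlt⟩))
    exact NetworkCoding.not_card_dvd_of_N3 hpp (NetworkCoding.two_le_g hpp hlt) hτ (h2 p hp)
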